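/- Let $\Delta$ be the open unit disc in $\mathbb C$ and let $V\subset\mathbb C$ be a bounded open set. A *weight* on an open set $U\subset\mathbb C$ is a continuous, bounded, strictly positive function on $U$. For a weight $v$ on $U$, $\mathcal H_v(U)$ is the space of holomorphic $f$ on $U$ with $\|f\|_v=\sup_{z\in U}v(z)|f(z)|<\infty$, and $\mathcal H_{v_o}(U)$ is the subspace of those $f$ such that for every $\varepsilon>0$ there is a compact $K\subset U$ with $v(z)|f(z)|<\varepsilon$ on $U\setminus K$. Write $\delta_z(f)=f(z)$. The weight $v$ is *complete* if for every $z\in U$ the functional $v(z)\delta_z$ is an extreme point of the closed unit ball of the dual $\mathcal H_{v_o}(U)'$. Let $v$ be a complete weight on $\Delta$, let $w$ be a weight on $V$, and let $T\colon\mathcal H_{v_o}(\Delta)\to\mathcal H_{w_o}(V)$ be a (complex-linear, not necessarily surjective) isometry. Let $\mathcal B_w^T(V)$ be the set of all $z\in V$ such that $w(z)\delta_z$ is an extreme point of the closed unit ball of the dual $T(\mathcal H_{v_o}(\Delta))'$. Say that $T$ is *induced* by $(\varphi,h)$ if $\varphi\colon V\to\Delta$ is an analytic surjection, $h$ is analytic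 on $V$ and $$T(f)(z)=h(z)\,f(\varphi(z))\qquad\text{for all } f\in\mathcal H_{v_o}(\Delta),\ z\in V.$$ (i) If $V$ is connected and $\mathcal H_{v_o}(\Delta)\neq\{0\}$, then $T$ is induced by some pair $(\varphi,h)$. (ii) Whenever $T$ is induced by $(\varphi,h)$, then for every $a\in\Delta$ and every $r>0$ the set $$\overline{\mathcal B_w^T(V)\cap\varphi^{-1}(B(a,r))}$$ has non-empty interior, where $B(a,r)=\{z\in\mathbb C:|z-a|<r\}$. -/

import Mathlib

noncomputable section

/-- A weight on `U ⊆ ℂ`: a continuous, bounded, strictly positive function on `U`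
(values outside `U` are irrelevant). -/
structure Weight (U : Set ℂ) where
  toFun : ℂ → ℝ
  continuousOn : ContinuousOn toFun U
  pos : ∀ z ∈ U, 0 < toFun z
  bounded : ∃ C : ℝ, ∀ z ∈ U, toFun z ≤ C

namespace Weight

variable {U : Set ℂ}

instance : CoeFun (Weight U) (fun _ => ℂ → ℝ) := ⟨Weight.toFun⟩

/-- The vector space of holomorphic functions `f` on `U` with `sup_{z ∈ U} v(z)|f(z)| < ∞`.
A function on `U` is represented by its extension by zero to `ℂ`. -/
def HSubmodule (v : Weight U) : Submodule ℂ (ℂ → ℂ) where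
  carrier := {f | DifferentiableOn ℂ f U ∧ (∀ z, z ∉ U → f z = 0) ∧
    ∃ C : ℝ, ∀ z ∈ U, v z * ‖f z‖ ≤ C}
  zero_mem' := ⟨differentiableOn_const 0, fun _ _ => rfl, 0, fun z _ => by simp⟩
  add_mem' := by
    rintro f g ⟨hf, hf0, C, hC⟩ ⟨hg, hg0, D, hD⟩
    refine ⟨hf.add hg, fun z hz => by simp [hf0 z hz, hg0 z hz], C + D, fun z hz => ?_⟩
    calc v z * ‖f z + g z‖ ≤ v z * (‖f z‖ + ‖g z‖) :=
          mul_le_mul_of_nonneg_left (norm_add_le _ _) (v.pos z hz).le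
      _ ≤ C + D := by rw [mul_add]; exact add_le_add (hC z hz) (hD z hz)
  smul_mem' := by
    rintro c f ⟨hf, hf0, C, hC⟩
    refine ⟨hf.const_smul c, fun z hz => by simp [hf0 z hz], ‖c‖ * C, fun z hz => ?_⟩
    have h := mul_le_mul_of_nonneg_left (hC z hz) (norm_nonneg c)
    simpa [mul_left_comm] using h

/-- The space `H_v(U)`. It is a type of its own, so that its topology is the one of the norm
below, not the topology of pointwise convergence. -/
def H (v : Weight U) : Type := v.HSubmodule

instance (v : Weight U) : AddCommGroup v.H := inferInstanceAs (AddCommGroup v.HSubmodule)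

instance (v : Weight U) : Module ℂ v.H := inferInstanceAs (Module ℂ v.HSubmodule)

/-- The elements of `H_v(U)` as functions. -/
instance (v : Weight U) : CoeFun v.H (fun _ => ℂ → ℂ) := ⟨Subtype.val⟩

@[simp] theorem coe_zero (v : Weight U) (z : ℂ) : (0 : v.H) z = 0 := rfl

@[simp] theorem coe_add (v : Weight U) (f g : v.H) (z : ℂ) : (f + g) z = f z + g z := rfl

@[simp] theorem coe_smul (v : Weight U) (c : ℂ) (f : v.H) (z : ℂ) : (c • f) z = c * f z := rfl

/-- The norm `‖f‖_v = sup_{z ∈ U} v(z)|f(z)|`. -/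
instance (v : Weight U) : Norm v.H := ⟨fun f => ⨆ z : U, v z * ‖f z‖⟩

theorem norm_def (v : Weight U) (f : v.H) : ‖f‖ = ⨆ z : U, v z * ‖f z‖ := rfl

theorem bddAbove (v : Weight U) (f : v.H) :
    BddAbove (Set.range fun z : U => v z * ‖f z‖) := by
  obtain ⟨C, hC⟩ := f.2.2.2
  exact ⟨C, by rintro _ ⟨z, rfl⟩; exact hC z z.2⟩

theorem le_norm (v : Weight U) (f : v.H) (z : U) : v z * ‖f z‖ ≤ ‖f‖ :=
  le_ciSup (v.bddAbove f) z

theorem norm_nonneg' (v : Weight U) (f : v.H) : 0 ≤ ‖f‖ :=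
  Real.iSup_nonneg fun z => mul_nonneg (v.pos z z.2).le (norm_nonneg _)

theorem normCore (v : Weight U) : NormedSpace.Core ℂ v.H where
  norm_nonneg := v.norm_nonneg'
  norm_smul c f := by
    rw [norm_def, norm_def, Real.mul_iSup_of_nonneg (norm_nonneg c)]
    exact iSup_congr fun z => by simp [mul_left_comm]
  norm_triangle f g := by
    refine Real.iSup_le (fun z => ?_) (add_nonneg (v.norm_nonneg' f) (v.norm_nonneg' g))
    calc v z * ‖f z + g z‖ ≤ v z * (‖f z‖ + ‖g z‖) :=
          mul_le_mul_of_nonneg_left (norm_add_le _ _) (v.pos z z.2).le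
      _ ≤ ‖f‖ + ‖g‖ := by rw [mul_add]; exact add_le_add (v.le_norm f z) (v.le_norm g z)
  norm_eq_zero_iff f := by
    constructor
    · intro h
      refine Subtype.ext (funext fun z => ?_)
      by_cases hz : z ∈ U
      · have h1 := v.le_norm f ⟨z, hz⟩
        rw [h] at h1
        have h2 : ‖f z‖ ≤ 0 := nonpos_of_mul_nonpos_right h1 (v.pos z hz)
        simpa using h2
      · exact f.2.2.1 z hz
    · rintro rfl
      simp [norm_def]

instance (v : Weight U) : NormedAddCommGroup v.H := NormedAddCommGroup.ofCore v.normCore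

instance (v : Weight U) : NormedSpace ℂ v.H := NormedSpace.ofCore v.normCore

/-- The subspace `H_{v_o}(U)` of all `f ∈ H_v(U)` such that `v(z)|f(z)|` tends to `0` as `z`
tends to the boundary of `U`: for every `ε > 0` there is a compact `K ⊆ U` with
`v(z)|f(z)| < ε` on `U \ K`. -/
def H₀ (v : Weight U) : Submodule ℂ v.H where
  carrier := {f | ∀ ε > 0, ∃ K ⊆ U, IsCompact K ∧ ∀ z ∈ U \ K, v z * ‖f z‖ < ε}
  zero_mem' := fun ε hε => ⟨∅, Set.empty_subset _, isCompact_empty, fun z _ => by simpa using hε⟩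
  add_mem' := by
    intro f g hf hg ε hε
    obtain ⟨K, hKU, hK, h1⟩ := hf (ε / 2) (half_pos hε)
    obtain ⟨L, hLU, hL, h2⟩ := hg (ε / 2) (half_pos hε)
    refine ⟨K ∪ L, Set.union_subset hKU hLU, hK.union hL, fun z hz => ?_⟩
    have a := h1 z ⟨hz.1, fun h => hz.2 (Or.inl h)⟩
    have b := h2 z ⟨hz.1, fun h => hz.2 (Or.inr h)⟩
    have c : v z * ‖f z + g z‖ ≤ v z * (‖f z‖ + ‖g z‖) :=
      mul_le_mul_of_nonneg_left (norm_add_le _ _) (v.pos z hz.1).le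
    change v z * ‖f z + g z‖ < ε
    linarith [mul_add (v z) ‖f z‖ ‖g z‖]
  smul_mem' := by
    intro c f hf ε hε
    have hc : 0 < ‖c‖ + 1 := by positivity
    obtain ⟨K, hKU, hK, h1⟩ := hf (ε / (‖c‖ + 1)) (div_pos hε hc)
    refine ⟨K, hKU, hK, fun z hz => ?_⟩
    have a := (lt_div_iff₀ hc).1 (h1 z hz)
    have b : 0 ≤ v z * ‖f z‖ := mul_nonneg (v.pos z hz.1).le (norm_nonneg _)
    change v z * ‖c * f z‖ < ε
    rw [norm_mul]
    nlinarith

/-- The evaluation functional `δ_z : f ↦ f(z)` on `H_v(U)`, for `z ∈ U`. -/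
def eval (v : Weight U) (z : U) : StrongDual ℂ v.H :=
  LinearMap.mkContinuous
    { toFun := fun f : v.H => f z
      map_add' := fun _ _ => rfl
      map_smul' := fun _ _ => rfl } (v z)⁻¹ (fun f => by
        have h := v.le_norm f z
        rw [inv_mul_eq_div, le_div_iff₀ (v.pos z z.2), mul_comm]
        exact h)

/-- For a subspace `E` of `H_v(U)`: the set of `z ∈ U` such that `v(z)δ_z`, restricted to `E`,
is an extreme point of the closed unit ball of the dual `E'`. -/
def boundaryOf (v : Weight U) (E : Submodule ℂ v.H) : Set ℂ :=
  {z | ∃ hz : z ∈ U, ((v z : ℂ) • (v.eval ⟨z, hz⟩).comp E.subtypeL) ∈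
    Set.extremePoints ℝ {e : StrongDual ℂ E | ‖e‖ ≤ 1}}

/-- The `v`-boundary `B_v(U)` of `U`. -/
def boundary (v : Weight U) : Set ℂ := v.boundaryOf v.H₀

/-- The weight `v` is complete if `B_v(U) = U`. -/
def IsComplete (v : Weight U) : Prop := v.boundary = U

/-- The set `B_w^T(V)`, for an isometry `T : H_{v_o}(U) → H_{w_o}(V)`: all `z ∈ V` such that
`w(z)δ_z` is an extreme point of the closed unit ball of the dual of the range `T(H_{v_o}(U))`. -/
def isometryBoundary {V : Set ℂ} {v : Weight U} {w : Weight V} (T : v.H₀ →ₗᵢ[ℂ] w.H₀) : Set ℂ :=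
  w.boundaryOf ((LinearMap.range T.toLinearMap).map w.H₀.subtype)

/-- `φ` is an analytic surjection of `V` onto `U` and `h` is analytic on `V`, with
`T(f)(z) = h(z) f(φ(z))` for all `f ∈ H_{v_o}(U)` and `z ∈ V`. -/
structure Induces {V : Set ℂ} {v : Weight U} {w : Weight V} (T : v.H₀ →ₗᵢ[ℂ] w.H₀)
    (φ h : ℂ → ℂ) : Prop where
  differentiableOn_map : DifferentiableOn ℂ φ V
  image_eq : φ '' V = U
  differentiableOn_factor : DifferentiableOn ℂ h V
  apply_eq : ∀ (f : v.H₀), ∀ z ∈ V, (T f : w.H) z = h z * (f : v.H) (φ z)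

end Weight

end

open Set Filter Topology

/-! Completeness makes every `v(a)δ_a` extreme in the dual ball. The functionals `c w(z) δ_z ∘ T`
with `|c| ≤ 1`, together with `0`, form a weak-* compact balanced norming set, so Milman's theorem
puts `v(a)δ_a` among them (`exists_eval_eq`). Hence there are points `Z a` in `V` with `T g (Z a) =
κ a * g a` and `κ a ≠ 0`.

For (i), `Z` is injective, so its image is uncountable and the identity theorem extends analytic
relations between the functions `T g` from `Z(Δ)` to all of `V`. Thus `φ = T(z f) / T f` does not
depend on `f`. The relation `T(z^n f) / T f = φ^n`, with `‖z^n f‖ ≤ ‖f‖`, gives `|φ| ≤ 1`; then `φ ∘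
Z = id` and the maximum principle give `φ(V) = Δ`. Dividing out zeros shows that `T f (z)` depends
only on `f (φ z)`, which yields `h` (`induces_of_forall_mulId`).

For (ii), the set `B = {v ∘ φ ≤ w |h|}` is relatively closed in `V`, lies in the isometry boundary
(`mem_isometryBoundary`), and is mapped onto `Δ` by `φ` (`Induces.exists_le`). A Baire argument,
with critical values discarded as a null set, gives `B` interior points over every nonempty open
subset of `Δ` (`nonempty_interior_of_subset_image`). The interior is found before any closure is
taken. -/

/-! ### Milman's theorem and norming sets in the dual ball -/

theorem isCompact_convexJoin {E : Type*} [AddCommGroup E] [Module ℝ E] [TopologicalSpace E]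
    [ContinuousAdd E] [ContinuousSMul ℝ E] {s t : Set E} (hs : IsCompact s) (ht : IsCompact t) :
    IsCompact (convexJoin ℝ s t) := by
  have h : convexJoin ℝ s t =
      (fun p : ℝ × E × E => (1 - p.1) • p.2.1 + p.1 • p.2.2) '' (Icc (0 : ℝ) 1 ×ˢ s ×ˢ t) := by
    ext x
    simp only [mem_convexJoin, segment_eq_image, mem_image, mem_prod, Prod.exists]
    grind
  rw [h]
  exact (isCompact_Icc.prod (hs.prod ht)).image (by fun_prop)

/-- **Milman's theorem**: if the closed convex hull of a closed subset `A` of a compact convex set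
`K` is `K`, then all extreme points of `K` are in `A`. -/
theorem mem_of_mem_extremePoints_of_subset_closure_convexHull {E : Type*} [AddCommGroup E]
    [Module ℝ E] [TopologicalSpace E] [IsTopologicalAddGroup E] [ContinuousSMul ℝ E]
    [LocallyConvexSpace ℝ E] [T2Space E] {K A : Set E} (hK : IsCompact K) (hKc : Convex ℝ K)
    (hA : IsCompact A) (hAK : A ⊆ K) (hKA : K ⊆ closure (convexHull ℝ A)) {x : E}
    (hx : x ∈ K.extremePoints ℝ) : x ∈ A := by
  by_contra hxA
  -- Compactness induction: small pieces of `A` lie in compact convex subsets of `K` missing `x`.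
  -- Two such subsets can be joined, since an extreme point lying on a segment in `K` is one of its
  -- endpoints.
  have key : ∃ D : Set E, IsCompact D ∧ Convex ℝ D ∧ D ⊆ K ∧ x ∉ D ∧ A ⊆ D := by
    refine hA.induction_on (p := fun S => ∃ D : Set E, IsCompact D ∧ Convex ℝ D ∧ D ⊆ K ∧ x ∉ D ∧
      S ⊆ D) ⟨∅, by simp [convex_empty]⟩ ?_ ?_ ?_
    · rintro s t hst ⟨D, h1, h2, h3, h4, h5⟩
      exact ⟨D, h1, h2, h3, h4, hst.trans h5⟩
    · rintro s t ⟨C, h1, h2, h3, h4, h5⟩ ⟨D, k1, k2, k3, k4, k5⟩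
      rcases C.eq_empty_or_nonempty with rfl | hC
      · exact ⟨D, k1, k2, k3, k4, union_subset (h5.trans (empty_subset _)) k5⟩
      rcases D.eq_empty_or_nonempty with rfl | hD
      · exact ⟨C, h1, h2, h3, h4, union_subset h5 (k5.trans (empty_subset _))⟩
      refine ⟨convexJoin ℝ C D, isCompact_convexJoin h1 k1, h2.convexJoin k2, convexJoin_subset h3 k3 hKc, ?_,
        union_subset (h5.trans (subset_convexJoin_left hD)) (k5.trans (subset_convexJoin_right hC))⟩
      intro hmem
      obtain ⟨c, hc, d, hd, hcd⟩ := mem_convexJoin.1 hmem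
      rcases (mem_extremePoints_iff_forall_segment.1 hx).2 c (h3 hc) d (k3 hd) hcd with h | h
      · exact h4 (h ▸ hc)
      · exact k4 (h ▸ hd)
    · intro a ha
      have hax : a ≠ x := fun h => hxA (h ▸ ha)
      obtain ⟨U, V, hU, hV, haU, hxV, hUV⟩ := t2_separation hax
      obtain ⟨C, ⟨hCa, hCc⟩, hCU⟩ :=
        (LocallyConvexSpace.convex_basis (𝕜 := ℝ) a).mem_iff.1 (hU.mem_nhds haU)
      refine ⟨K ∩ C, inter_mem (mem_of_superset self_mem_nhdsWithin hAK) (mem_nhdsWithin_of_mem_nhds hCa),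
        K ∩ closure C, hK.inter_right isClosed_closure, hKc.inter hCc.closure, inter_subset_left,
        ?_, inter_subset_inter_right _ subset_closure⟩
      rintro ⟨-, hxC⟩
      exact (hUV.mono_left hCU).closure_left hV |>.le_bot ⟨hxC, hxV⟩
  obtain ⟨D, h1, h2, h3, h4, h5⟩ := key
  exact h4 (closure_minimal (convexHull_min h5 h2) h1.isClosed (hKA hx.1))

/-- Milman's theorem, with the condition on closed convex hulls expressed through functionals. -/
theorem mem_of_mem_extremePoints_of_forall_re_le {E : Type*} [AddCommGroup E]
    [Module ℝ E] [Module ℂ E] [IsScalarTower ℝ ℂ E] [TopologicalSpace E] [IsTopologicalAddGroup E]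
    [ContinuousSMul ℂ E] [LocallyConvexSpace ℝ E] [T2Space E] {K A : Set E} (hK : IsCompact K)
    (hKc : Convex ℝ K) (hA : IsCompact A) (hAK : A ⊆ K)
    (hKA : ∀ (f : StrongDual ℂ E) (u : ℝ), (∀ a ∈ A, (f a).re ≤ u) → ∀ k ∈ K, (f k).re ≤ u) {x : E}
    (hx : x ∈ K.extremePoints ℝ) : x ∈ A := by
  have : ContinuousSMul ℝ E := IsScalarTower.continuousSMul ℂ
  refine mem_of_mem_extremePoints_of_subset_closure_convexHull hK hKc hA hAK (fun k hk => ?_) hx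
  by_contra hkA
  obtain ⟨f, u, hfu, huk⟩ := RCLike.geometric_hahn_banach_closed_point (𝕜 := ℂ)
    (convex_convexHull ℝ A).closure isClosed_closure hkA
  exact huk.not_ge (hKA f u (fun a ha => (hfu a (subset_closure (subset_convexHull ℝ A ha))).le)
    k hk)

/-- Extreme points of the unit ball of the dual belong to every weak-* compact balanced norming
subset of the unit ball. -/
theorem mem_of_mem_extremePoints_dual_unitBall {E : Type*} [NormedAddCommGroup E]
    [NormedSpace ℂ E] {A : Set (WeakDual ℂ E)} (hA : IsCompact A)
    (hAb : ∀ c : ℂ, ‖c‖ ≤ 1 → ∀ a ∈ A, c • a ∈ A)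
    (hA1 : ∀ a ∈ A, ‖WeakDual.toStrongDual a‖ ≤ 1)
    (hAn : ∀ (x : E) (M : ℝ), 0 ≤ M → (∀ a ∈ A, ‖a x‖ ≤ M) → ‖x‖ ≤ M) (hne : A.Nonempty)
    {e : StrongDual ℂ E} (he : e ∈ extremePoints ℝ {e : StrongDual ℂ E | ‖e‖ ≤ 1}) :
    StrongDual.toWeakDual e ∈ A := by
  have hst : IsScalarTower ℝ ℂ (WeakDual ℂ E) :=
    ⟨fun r c a => DFunLike.ext _ _ fun x => smul_assoc r c (a x)⟩
  have hlc : LocallyConvexSpace ℝ (WeakDual ℂ E) :=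
    (WeakDual.withSeminorms ℂ E).toLocallyConvexSpace
  let K : Set (WeakDual ℂ E) := WeakDual.toStrongDual ⁻¹' Metric.closedBall 0 1
  have hK : IsCompact K := WeakDual.isCompact_closedBall 0 1
  have hmemK : ∀ a : WeakDual ℂ E, a ∈ K ↔ ‖WeakDual.toStrongDual a‖ ≤ 1 := fun a => by
    simp [K]
  have hKc : Convex ℝ K := by
    have := (convex_closedBall (0 : StrongDual ℂ E) 1)
    intro x hx y hy a b ha hb hab
    exact this hx hy ha hb hab
  refine @mem_of_mem_extremePoints_of_forall_re_le (WeakDual ℂ E) _ _ _ hst _ _ _ hlc _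
    K A hK hKc hA (fun a ha => (hmemK a).2 (hA1 a ha)) ?_ _ ?_
  · intro f u hfu k hk
    -- Weak-* continuous functionals on the dual are evaluations at vectors.
    obtain ⟨x, hx⟩ := LinearMap.dualEmbedding_surjective (topDualPairing ℂ E) f
    have hfx : ∀ a : WeakDual ℂ E, f a = a x := fun a => by rw [← hx]; rfl
    simp only [hfx] at hfu ⊢
    have hu : ∀ a ∈ A, ‖a x‖ ≤ u := by
      intro a ha
      by_cases h0 : a x = 0
      · obtain ⟨b, hb⟩ := hne
        have h1 : ((0 : ℂ) • b) x = 0 := zero_mul (b x)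
        have h2 := hfu _ (hAb 0 (by simp) b hb)
        rw [h1] at h2
        simpa [h0] using h2
      · have hn : (‖a x‖ : ℂ) ≠ 0 := by simpa using h0
        have h1 := hfu _ (hAb (starRingEnd ℂ (a x) / ‖a x‖) (by simp [h0]) a ha)
        have h2 : ((starRingEnd ℂ (a x) / ‖a x‖) • a) x = ‖a x‖ := by
          change starRingEnd ℂ (a x) / ‖a x‖ * a x = ‖a x‖
          rw [div_mul_eq_mul_div, Complex.conj_mul', div_eq_iff hn, sq]
        rw [h2] at h1
        simpa using h1
    have hu0 : 0 ≤ u := by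
      obtain ⟨b, hb⟩ := hne
      exact (norm_nonneg _).trans (hu b hb)
    have h2 : ‖k x‖ ≤ 1 * ‖x‖ := (WeakDual.toStrongDual k).le_of_opNorm_le ((hmemK k).1 hk) x
    linarith [hAn x u hu0 hu, (k x).re_le_norm]
  · refine ⟨(hmemK _).2 he.1, fun y hy z hz hyz => ?_⟩
    exact congrArg StrongDual.toWeakDual (he.2 ((hmemK y).1 hy) ((hmemK z).1 hz) hyz)

/-! ### Extreme functionals seen through an isometry -/

/-- The set fed to Milman's theorem is the balanced hull of the evaluations pulled back by `T`. It
is norming because `T` preserves the supremum norm; scalars with `‖c‖ < 1` are the price of a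
compact balanced set. -/
theorem exists_isometry_eval_of_extreme {V : Set ℂ} {w : Weight V} {E : Type*}
    [NormedAddCommGroup E] [NormedSpace ℂ E] [Nontrivial E] (T : E →ₗᵢ[ℂ] w.H₀)
    {e : StrongDual ℂ E} (he : e ∈ extremePoints ℝ {e : StrongDual ℂ E | ‖e‖ ≤ 1}) :
    e ≠ 0 ∧ ∃ z ∈ V, ∃ c : ℂ, ‖c‖ ≤ 1 ∧ ∀ g : E, e g = c * (w z * (T g : w.H) z) := by
  have he0 : e ≠ 0 := by
    rintro rfl
    obtain ⟨x, hx⟩ := exists_norm_eq (StrongDual ℂ E) zero_le_one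
    have : (0 : StrongDual ℂ E) ∈ openSegment ℝ x (-x) :=
      ⟨1/2, 1/2, by norm_num, by norm_num, by norm_num, by simp⟩
    have h := he.2 (x₁ := x) hx.le (x₂ := -x) (by simp [hx]) this
    simp [h] at hx
  refine ⟨he0, ?_⟩
  let ev : V → StrongDual ℂ E := fun z =>
    (w z : ℂ) • ((w.eval z).comp w.H₀.subtypeL).comp T.toContinuousLinearMap
  have hev : ∀ z g, ev z g = w z * (T g : w.H) z := fun z g => rfl
  have hevn : ∀ z g, ‖ev z g‖ = w z * ‖(T g : w.H) z‖ := fun z g => by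
    rw [hev, norm_mul, Complex.norm_real, Real.norm_of_nonneg (w.pos z z.2).le]
  -- The vanishing condition defining `H₀` is exactly weak-* continuity at infinity with value `0`.
  let F : OnePoint V → WeakDual ℂ E := fun o => o.elim 0 (fun z => StrongDual.toWeakDual (ev z))
  have hF : Continuous F := by
    refine WeakDual.continuous_of_continuous_eval fun g => ?_
    rw [OnePoint.continuous_iff]
    constructor
    · change Tendsto (fun z : V => ev z g) _ (𝓝 0)
      rw [tendsto_zero_iff_norm_tendsto_zero, Metric.tendsto_nhds]
      intro ε hε
      obtain ⟨K, hKV, hK, hKε⟩ := (T g).2 ε hε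
      have hK' : IsCompact ((↑) ⁻¹' K : Set V) := by
        rw [Subtype.isCompact_iff, image_preimage_eq_inter_range, Subtype.range_coe,
          inter_eq_left.2 hKV]
        exact hK
      rw [coclosedCompact_eq_cocompact]
      filter_upwards [hK'.compl_mem_cocompact] with z hz
      have := hKε z ⟨z.2, hz⟩
      rw [dist_zero_right, norm_norm, hevn]
      exact this
    · change Continuous (fun z : V => ev z g)
      simp_rw [hev]
      have h1 : Continuous fun z : V => (T g : w.H) z :=
        continuousOn_iff_continuous_domRestrict.1 (T g : w.H).2.1.continuousOn
      have h2 : Continuous fun z : V => w z :=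
        continuousOn_iff_continuous_domRestrict.1 w.continuousOn
      fun_prop
  let A : Set (WeakDual ℂ E) :=
    (fun p : ℂ × OnePoint V => p.1 • F p.2) '' (Metric.closedBall 0 1 ×ˢ univ)
  have hA : IsCompact A :=
    ((isCompact_closedBall _ _).prod isCompact_univ).image
      (continuous_fst.smul (hF.comp continuous_snd))
  have hmem := mem_of_mem_extremePoints_dual_unitBall hA ?_ ?_ ?_
    ⟨_, mem_image_of_mem _ (show ((0 : ℂ), (OnePoint.infty : OnePoint V)) ∈ _ by simp)⟩ he
  · obtain ⟨⟨c, o⟩, ⟨hcm, -⟩, hco⟩ := hmem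
    have hc : ‖c‖ ≤ 1 := by simpa using hcm
    induction o using OnePoint.rec with
    | infty =>
      refine absurd ?_ he0
      have : (c • (0 : WeakDual ℂ E)) = StrongDual.toWeakDual e := hco
      rw [smul_zero] at this
      exact (StrongDual.toWeakDual_inj e 0).1 this.symm
    | coe z => exact ⟨z, z.2, c, hc, fun g => (DFunLike.congr_fun hco g).symm⟩
  · rintro c hc _ ⟨⟨d, o⟩, ⟨hdm, -⟩, rfl⟩
    refine ⟨(c * d, o), ⟨?_, mem_univ _⟩, mul_smul _ _ _⟩
    have hd : ‖d‖ ≤ 1 := by simpa using hdm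
    simpa using mul_le_one₀ hc (norm_nonneg d) hd
  · rintro _ ⟨⟨d, o⟩, ⟨hdm, -⟩, rfl⟩
    have hd : ‖d‖ ≤ 1 := by simpa using hdm
    refine ContinuousLinearMap.opNorm_le_bound _ zero_le_one fun g => ?_
    induction o using OnePoint.rec with
    | infty =>
      change ‖d * 0‖ ≤ _
      simp
    | coe z =>
      change ‖d * ev z g‖ ≤ _
      rw [norm_mul, hevn]
      have h := w.le_norm (T g) z
      have h' : ‖(T g : w.H)‖ = ‖g‖ := T.norm_map g
      rw [h'] at h
      exact mul_le_mul hd h (mul_nonneg (w.pos z z.2).le (norm_nonneg _)) zero_le_one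
  · intro g M hM hg
    rw [← T.norm_map g]
    refine Real.iSup_le (fun z => ?_) hM
    have := hg (1 • F z) ⟨(1, z), by simp, by simp⟩
    rw [one_smul] at this
    exact (hevn z g).symm.trans_le this

/-! ### Multiplication by the coordinate and division of zeros -/

namespace Weight

variable {U : Set ℂ}

/-- A function satisfying the vanishing condition of `H₀` is automatically bounded. -/
def mkH₀ (v : Weight U) (f : ℂ → ℂ) (hf : DifferentiableOn ℂ f U) (hf0 : ∀ z, z ∉ U → f z = 0)
    (hv : ∀ ε > 0, ∃ K ⊆ U, IsCompact K ∧ ∀ z ∈ U \ K, v z * ‖f z‖ < ε) : v.H₀ :=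
  ⟨⟨f, hf, hf0, by
    obtain ⟨K, hKU, hK, hK1⟩ := hv 1 one_pos
    obtain ⟨C, hC⟩ := (hK.image_of_continuousOn (f := fun z => v z * ‖f z‖)
      ((v.continuousOn.mono hKU).mul (hf.continuousOn.mono hKU).norm)).bddAbove
    refine ⟨max C 1, fun z hz => ?_⟩
    by_cases hzK : z ∈ K
    · exact (hC (mem_image_of_mem _ hzK)).trans (le_max_left _ _)
    · exact (hK1 z ⟨hz, hzK⟩).le.trans (le_max_right _ _)⟩, hv⟩

theorem ext_H₀ {v : Weight U} {f g : v.H₀} (h : ∀ z ∈ U, (f : v.H) z = (g : v.H) z) : f = g := by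
  refine Subtype.ext (Subtype.ext (funext fun z => ?_))
  by_cases hz : z ∈ U
  · exact h z hz
  · exact ((f : v.H).2.2.1 z hz).trans ((g : v.H).2.2.1 z hz).symm

/-- `f ↦ (z ↦ z f(z))` on `H₀`, over the unit disc. -/
def mulId {v : Weight (Metric.ball (0 : ℂ) 1)} (f : v.H₀) : v.H₀ :=
  v.mkH₀ (fun z => z * (f : v.H) z) (differentiableOn_id.mul (f : v.H).2.1)
    (fun z hz => by simp [(f : v.H).2.2.1 z hz]) (fun ε hε => by
      obtain ⟨K, hKU, hK, h⟩ := f.2 ε hε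
      refine ⟨K, hKU, hK, fun z hz => lt_of_le_of_lt ?_ (h z hz)⟩
      have hz1 : ‖z‖ ≤ 1 := (mem_ball_zero_iff.1 hz.1).le
      rw [norm_mul]
      exact mul_le_mul_of_nonneg_left (mul_le_of_le_one_left (norm_nonneg _) hz1)
        (v.pos z hz.1).le)

@[simp] theorem coe_mulId {v : Weight (Metric.ball (0 : ℂ) 1)} (f : v.H₀) (z : ℂ) :
    (mulId f : v.H) z = z * (f : v.H) z := rfl

theorem norm_mulId_le {v : Weight (Metric.ball (0 : ℂ) 1)} (f : v.H₀) : ‖mulId f‖ ≤ ‖f‖ := by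
  refine Real.iSup_le (fun z => ?_) (norm_nonneg _)
  refine le_trans ?_ (v.le_norm f z)
  have hz1 : ‖(z : ℂ)‖ ≤ 1 := (mem_ball_zero_iff.1 z.2).le
  change v z * ‖(z : ℂ) * (f : v.H) z‖ ≤ v z * ‖(f : v.H) z‖
  rw [norm_mul]
  exact mul_le_mul_of_nonneg_left (mul_le_of_le_one_left (norm_nonneg _) hz1) (v.pos z z.2).le

theorem coe_mulId_iterate {v : Weight (Metric.ball (0 : ℂ) 1)} (f : v.H₀) (n : ℕ) (z : ℂ) :
    (mulId^[n] f : v.H) z = z ^ n * (f : v.H) z := by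
  induction n with
  | zero => simp
  | succ n ih => rw [Function.iterate_succ_apply', coe_mulId, ih]; ring

theorem norm_mulId_iterate_le {v : Weight (Metric.ball (0 : ℂ) 1)} (f : v.H₀) (n : ℕ) :
    ‖mulId^[n] f‖ ≤ ‖f‖ := by
  induction n with
  | zero => simp
  | succ n ih => rw [Function.iterate_succ_apply']; exact (norm_mulId_le _).trans ih

/-- Zeros of functions in `H₀` can be divided out. -/
theorem exists_eq_sub_mul {v : Weight (Metric.ball (0 : ℂ) 1)} (f : v.H₀) {b : ℂ}
    (hb : b ∈ Metric.ball (0 : ℂ) 1) (hfb : (f : v.H) b = 0) :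
    ∃ k : v.H₀, f = mulId k - b • k := by
  have hds : ∀ z, (z - b) * dslope (f : v.H) b z = (f : v.H) z := fun z => by
    simpa [hfb] using sub_smul_dslope (f : v.H) b z
  obtain ⟨r, hr, hrU⟩ := Metric.nhds_basis_closedBall.mem_iff.1 (Metric.isOpen_ball.mem_nhds hb)
  refine ⟨v.mkH₀ (dslope (f : v.H) b) ((Complex.differentiableOn_dslope
    (Metric.isOpen_ball.mem_nhds hb)).2 (f : v.H).2.1) (fun z hz => ?_) (fun ε hε => ?_),
    ext_H₀ fun z _ => ?_⟩
  · have hzb : z - b ≠ 0 := sub_ne_zero.2 fun h => hz (h ▸ hb)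
    have := hds z
    rw [(f : v.H).2.2.1 z hz] at this
    exact (mul_eq_zero.1 this).resolve_left hzb
  -- Off the closed ball of radius `r` about `b`, division by `z - b` costs at most a factor `1 /
  -- r`; the ball itself is absorbed into the compact set.
  · obtain ⟨K, hKU, hK, h⟩ := f.2 (r * ε) (mul_pos hr hε)
    refine ⟨K ∪ Metric.closedBall b r, union_subset hKU hrU, hK.union (isCompact_closedBall b r),
      fun z hz => ?_⟩
    have h1 := h z ⟨hz.1, fun hzK => hz.2 (Or.inl hzK)⟩
    have h2 : r < ‖z - b‖ := by
      rw [← dist_eq_norm]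
      exact not_le.1 fun hzb => hz.2 (Or.inr hzb)
    rw [← hds z, norm_mul] at h1
    have h3 : 0 ≤ v z * ‖dslope (f : v.H) b z‖ := mul_nonneg (v.pos z hz.1).le (norm_nonneg _)
    nlinarith
  · change (f : v.H) z = z * dslope (f : v.H) b z - b * dslope (f : v.H) b z
    rw [← sub_mul, hds]

/-- Every `v(a)δ_a`, for a complete weight, is a multiple of some `w(z)δ_z` under an isometry. -/
theorem exists_eval_eq {V : Set ℂ} {v : Weight U} {w : Weight V} (hv : v.IsComplete)
    [Nontrivial v.H₀] (T : v.H₀ →ₗᵢ[ℂ] w.H₀) {a : ℂ} (ha : a ∈ U) :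
    (∃ f : v.H₀, (f : v.H) a ≠ 0) ∧ ∃ z ∈ V, ∃ c : ℂ, ‖c‖ ≤ 1 ∧
      ∀ g : v.H₀, v a * (g : v.H) a = c * (w z * (T g : w.H) z) := by
  obtain ⟨_, hae⟩ : a ∈ v.boundary := by rw [hv]; exact ha
  obtain ⟨h0, h⟩ := exists_isometry_eval_of_extreme T hae
  refine ⟨?_, h⟩
  by_contra! hf
  exact h0 (ContinuousLinearMap.ext fun g => by
    change (v a : ℂ) * (g : v.H) a = 0
    rw [hf g, mul_zero])

end Weight

/-! ### Analytic quotients and the identity theorem -/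

/-- If `‖F‖ ≤ ‖G‖` and the zeros of `G` are isolated, then `F / G` extends analytically. -/
theorem exists_differentiableOn_eq_mul_of_norm_le {V : Set ℂ} (hV : IsOpen V) {F G : ℂ → ℂ}
    (hF : DifferentiableOn ℂ F V) (hG : DifferentiableOn ℂ G V)
    (hG0 : ∀ z ∈ V, ∀ᶠ y in 𝓝[≠] z, G y ≠ 0) (hFG : ∀ z ∈ V, ‖F z‖ ≤ ‖G z‖) :
    ∃ φ : ℂ → ℂ, DifferentiableOn ℂ φ V ∧ (∀ z ∈ V, ‖φ z‖ ≤ 1) ∧ ∀ z ∈ V, F z = φ z * G z := by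
  let q : ℂ → ℂ := fun z => F z / G z
  let φ : ℂ → ℂ := fun z => limUnder (𝓝[≠] z) q
  have hq1 : ∀ z ∈ V, ‖q z‖ ≤ 1 := fun z hz => by
    rw [norm_div]
    exact div_le_one_of_le₀ (hFG z hz) (norm_nonneg _)
  have hqd : ∀ z ∈ V, G z ≠ 0 → DifferentiableAt ℂ q z := fun z hz h0 =>
    (hF.differentiableAt (hV.mem_nhds hz)).div (hG.differentiableAt (hV.mem_nhds hz)) h0
  have hφq : ∀ z ∈ V, G z ≠ 0 → φ z = q z := fun z hz h0 =>
    ((hqd z hz h0).continuousAt.tendsto.mono_left nhdsWithin_le_nhds).limUnder_eq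
  have hφd : DifferentiableOn ℂ φ V := by
    intro z hz
    obtain ⟨s, hs, hsV⟩ : ∃ s ∈ 𝓝 z, s ⊆ V ∧ ∀ y ∈ s \ {z}, G y ≠ 0 := by
      have := (hV.mem_nhds hz)
      refine ⟨_, inter_mem this (eventually_nhdsWithin_iff.1 (hG0 z hz)), inter_subset_left, ?_⟩
      rintro y ⟨⟨-, hy⟩, hyz⟩
      exact hy hyz
    have h1 := Complex.differentiableOn_update_limUnder_of_bddAbove hs (f := q)
      (fun y hy => (hqd y (hsV.1 hy.1) (hsV.2 y hy)).differentiableWithinAt)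
      ⟨1, by rintro _ ⟨y, hy, rfl⟩; exact hq1 y (hsV.1 hy.1)⟩
    refine (((h1.differentiableAt hs).congr_of_eventuallyEq ?_)).differentiableWithinAt
    filter_upwards [hs] with y hy
    by_cases hyz : y = z
    · subst hyz; simp [φ]
    · rw [Function.update_of_ne hyz]
      exact hφq y (hsV.1 hy) (hsV.2 y ⟨hy, hyz⟩)
  refine ⟨φ, hφd, fun z hz => ?_, fun z hz => ?_⟩
  · have hc : ContinuousAt φ z := hφd.continuousOn.continuousAt (hV.mem_nhds hz)
    refine le_of_tendsto (hc.norm.tendsto.mono_left (nhdsWithin_le_nhds (s := {z}ᶜ))) ?_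
    filter_upwards [hG0 z hz, mem_nhdsWithin_of_mem_nhds (hV.mem_nhds hz)] with y hy hyV
    rw [hφq y hyV hy]
    exact hq1 y hyV
  · by_cases h0 : G z = 0
    · have := hFG z hz
      simp_all
    · rw [hφq z hz h0, div_mul_cancel₀ _ h0]

/-- Identity theorem for functions agreeing on an uncountable set. -/
theorem eqOn_of_eqOn_of_not_countable {V S : Set ℂ} (hV : IsOpen V) (hVc : IsPreconnected V)
    {F G : ℂ → ℂ} (hF : DifferentiableOn ℂ F V) (hG : DifferentiableOn ℂ G V) (hSV : S ⊆ V)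
    (hS : ¬ S.Countable) (h : EqOn F G S) : EqOn F G V := by
  -- The accumulation point must lie in `S`, hence in `V`. A subset of the plane without
  -- accumulation points of its own is discrete, hence countable.
  obtain ⟨x, hx, hxS⟩ : ∃ x ∈ S, AccPt x (𝓟 S) := by
    by_contra! hno
    have : DiscreteTopology S := discreteTopology_of_noAccPts hno
    exact hS (Set.countable_coe_iff.mp <| TopologicalSpace.separableSpace_iff_countable.mp
      inferInstance)
  refine (hF.analyticOnNhd hV).eqOn_of_preconnected_of_frequently_eq (hG.analyticOnNhd hV) hVc
    (hSV hx) ?_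
  exact (accPt_iff_frequently_nhdsNE.1 hxS).mono fun y hy => h hy

theorem not_countable_ball : ¬ (Metric.ball (0 : ℂ) 1).Countable := fun h =>
  (Metric.measure_ball_pos MeasureTheory.volume (0 : ℂ) one_pos).ne' (h.measure_zero _)

/-! ### Isometries as weighted composition operators -/

namespace Weight

variable {V : Set ℂ} {v : Weight (Metric.ball (0 : ℂ) 1)} {w : Weight V}

theorem exists_apply_eq_mul (hv : v.IsComplete) [Nontrivial v.H₀] (T : v.H₀ →ₗᵢ[ℂ] w.H₀) :
    ∃ Z κ : ℂ → ℂ, ∀ a ∈ Metric.ball (0 : ℂ) 1, Z a ∈ V ∧ κ a ≠ 0 ∧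
      ∀ g : v.H₀, (T g : w.H) (Z a) = κ a * (g : v.H) a := by
  have : ∀ a : ℂ, ∃ z κ : ℂ, a ∈ Metric.ball (0 : ℂ) 1 → z ∈ V ∧ κ ≠ 0 ∧
      ∀ g : v.H₀, (T g : w.H) z = κ * (g : v.H) a := by
    intro a
    by_cases ha : a ∈ Metric.ball (0 : ℂ) 1
    · obtain ⟨⟨f, hf⟩, z, hz, c, -, hc⟩ := exists_eval_eq hv T ha
      have hva : (v a : ℂ) ≠ 0 := by exact_mod_cast (v.pos a ha).ne'
      have hwz : (w z : ℂ) ≠ 0 := by exact_mod_cast (w.pos z hz).ne'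
      have hc0 : c ≠ 0 := by
        rintro rfl
        have := hc f
        simp_all
      refine ⟨z, v a / (c * w z), fun _ => ⟨hz, by positivity, fun g => ?_⟩⟩
      have := hc g
      field_simp
      linear_combination -this
    · exact ⟨0, 0, fun h => absurd h ha⟩
  choose Z κ h using this
  exact ⟨Z, κ, h⟩

theorem differentiableOn_coe {U : Set ℂ} {v : Weight U} (f : v.H₀) :
    DifferentiableOn ℂ (f : v.H) U := (f : v.H).2.1

/-- If `g` vanishes at `φ z`, then `g = (id - φ z) k`, and `hT` forces `T g` to vanish at `z`. So `g
↦ T g z` is a multiple of evaluation at `φ z`. -/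
theorem induces_of_forall_mulId (hVo : IsOpen V) (T : v.H₀ →ₗᵢ[ℂ] w.H₀) {φ : ℂ → ℂ}
    (hφd : DifferentiableOn ℂ φ V) (hφ : φ '' V = Metric.ball 0 1)
    (hne : ∀ b ∈ Metric.ball (0 : ℂ) 1, ∃ f : v.H₀, (f : v.H) b ≠ 0)
    (hT : ∀ g : v.H₀, ∀ z ∈ V, (T (mulId g) : w.H) z = φ z * (T g : w.H) z) :
    ∃ h : ℂ → ℂ, Induces T φ h := by
  have hmem : ∀ z ∈ V, φ z ∈ Metric.ball (0 : ℂ) 1 := fun z hz => hφ ▸ mem_image_of_mem φ hz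
  have hzero : ∀ g : v.H₀, ∀ z ∈ V, (g : v.H) (φ z) = 0 → (T g : w.H) z = 0 := by
    intro g z hz hg
    obtain ⟨k, hk⟩ := exists_eq_sub_mul g (hmem z hz) hg
    rw [hk, map_sub, map_smul]
    change (T (mulId k) : w.H) z - φ z * (T k : w.H) z = 0
    rw [hT k z hz, sub_self]
  have hcross : ∀ f g : v.H₀, ∀ z ∈ V,
      (f : v.H) (φ z) * (T g : w.H) z = (g : v.H) (φ z) * (T f : w.H) z := by
    intro f g z hz
    have := hzero ((f : v.H) (φ z) • g - (g : v.H) (φ z) • f) z hz ?_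
    · rw [map_sub, map_smul, map_smul] at this
      exact sub_eq_zero.1 this
    · change (f : v.H) (φ z) * (g : v.H) (φ z) - (g : v.H) (φ z) * (f : v.H) (φ z) = 0
      ring
  have : ∀ b : ℂ, ∃ f : v.H₀, b ∈ Metric.ball (0 : ℂ) 1 → (f : v.H) b ≠ 0 := fun b => by
    by_cases hb : b ∈ Metric.ball (0 : ℂ) 1
    · exact (hne b hb).imp fun f hf _ => hf
    · exact ⟨0, fun h => absurd h hb⟩
  choose G hG using this
  let h : ℂ → ℂ := fun z => (T (G (φ z)) : w.H) z / (G (φ z) : v.H) (φ z)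
  have happ : ∀ g : v.H₀, ∀ z ∈ V, (T g : w.H) z = h z * (g : v.H) (φ z) := by
    intro g z hz
    have h0 := hG _ (hmem z hz)
    have h1 := hcross (G (φ z)) g z hz
    simp only [h]
    field_simp
    linear_combination h1
  refine ⟨h, hφd, hφ, fun z hz => ?_, happ⟩
  -- The test function in `h` varies with the point; near a given `z` the single function `G (φ z)`
  -- computes `h`.
  have hφz := hφd.differentiableAt (hVo.mem_nhds hz)
  have hgd : DifferentiableAt ℂ (fun y => (G (φ z) : v.H) (φ y)) z :=
    ((differentiableOn_coe (G (φ z))).differentiableAt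
      (Metric.isOpen_ball.mem_nhds (hmem z hz))).comp z hφz
  have hg0 := hG _ (hmem z hz)
  have hTd : DifferentiableAt ℂ (T (G (φ z)) : w.H) z :=
    (differentiableOn_coe (T (G (φ z)))).differentiableAt (hVo.mem_nhds hz)
  refine ((hTd.fun_div hgd hg0).congr_of_eventuallyEq ?_).differentiableWithinAt
  filter_upwards [hVo.mem_nhds hz, hgd.continuousAt.eventually_ne hg0] with y hy hy0
  rw [happ (G (φ z)) y hy, mul_div_cancel_right₀ _ hy0]

/-- A linear isometry from `H₀` over the disc with a complete weight into `H₀` over a connected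
open set is a weighted composition operator. -/
theorem exists_induces (hVo : IsOpen V) (hVc : IsConnected V) (hv : v.IsComplete)
    [Nontrivial v.H₀] (T : v.H₀ →ₗᵢ[ℂ] w.H₀) : ∃ φ h : ℂ → ℂ, Induces T φ h := by
  have hne : ∀ b ∈ Metric.ball (0 : ℂ) 1, ∃ f : v.H₀, (f : v.H) b ≠ 0 := fun b hb =>
    (exists_eval_eq hv T hb).1
  obtain ⟨Z, κ, hZ⟩ := exists_apply_eq_mul hv T
  -- The ratio of `T (mulId g)` to `T g` at `Z a` is `a`, so `Z a` determines `a`.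
  have hinj : InjOn Z (Metric.ball 0 1) := by
    intro a ha b hb hab
    obtain ⟨g, hg⟩ := hne a ha
    obtain ⟨-, hκa, hTa⟩ := hZ a ha
    obtain ⟨-, hκb, hTb⟩ := hZ b hb
    have h1 := hTa (mulId g)
    have h2 := hTa g
    have h3 := hTb (mulId g)
    have h4 := hTb g
    rw [← hab] at h3 h4
    rw [coe_mulId] at h1 h3
    have h5 : κ a * (g : v.H) a * (a - b) = 0 := by linear_combination h3 - h1 + b * h2 - b * h4
    exact sub_eq_zero.1 ((mul_eq_zero.1 h5).resolve_left (mul_ne_zero hκa hg))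
  have hident : ∀ F G : ℂ → ℂ, DifferentiableOn ℂ F V → DifferentiableOn ℂ G V →
      (∀ a ∈ Metric.ball (0 : ℂ) 1, F (Z a) = G (Z a)) → EqOn F G V := by
    intro F G hF hG h
    refine eqOn_of_eqOn_of_not_countable hVo hVc.isPreconnected hF hG
      (S := Z '' Metric.ball 0 1) ?_ (fun hc => ?_) ?_
    · rintro _ ⟨a, ha, rfl⟩
      exact (hZ a ha).1
    · exact not_countable_ball (countable_of_injective_of_countable_image hinj hc)
    · rintro _ ⟨a, ha, rfl⟩
      exact h a ha
  have h0 : (0 : ℂ) ∈ Metric.ball (0 : ℂ) 1 := Metric.mem_ball_self one_pos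
  obtain ⟨f, hf⟩ := hne 0 h0
  have hd : ∀ g : v.H₀, DifferentiableOn ℂ (T g : w.H) V := fun g => differentiableOn_coe (T g)
  -- Denominator-free form of `T(z^(n+1) f) / T f = (T(z f) / T f)^(n+1)`. A ratio of modulus above
  -- `1` would contradict the uniform bound on `‖z^(n+1) f‖`; at zeros of `T f` the case `n = 1`
  -- suffices.
  have hpow : ∀ n : ℕ, ∀ z ∈ V, (T (mulId^[n + 1] f) : w.H) z * (T f : w.H) z ^ n =
      (T (mulId f) : w.H) z ^ (n + 1) := fun n =>
    hident (fun z => (T (mulId^[n + 1] f) : w.H) z * (T f : w.H) z ^ n)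
      (fun z => (T (mulId f) : w.H) z ^ (n + 1)) ((hd _).fun_mul ((hd _).fun_pow _))
      ((hd _).fun_pow _) fun a ha => by
        simp only [(hZ a ha).2.2, coe_mulId_iterate, coe_mulId]
        ring
  have hle : ∀ z ∈ V, ‖(T (mulId f) : w.H) z‖ ≤ ‖(T f : w.H) z‖ := by
    intro z hz
    by_cases hz0 : (T f : w.H) z = 0
    · have := hpow 1 z hz
      rw [hz0, pow_one, mul_zero] at this
      rw [pow_eq_zero_iff two_ne_zero |>.1 this.symm, norm_zero]
      exact norm_nonneg _
    set x : ℝ := ‖(T (mulId f) : w.H) z‖ / ‖(T f : w.H) z‖ with hx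
    have hz0' : 0 < ‖(T f : w.H) z‖ := norm_pos_iff.2 hz0
    suffices x ≤ 1 from (div_le_one hz0').1 this
    by_contra! hx1
    have hbound : ∀ n : ℕ, x ^ (n + 1) ≤ ‖f‖ / (w z * ‖(T f : w.H) z‖) := by
      intro n
      have h1 := w.le_norm (T (mulId^[n + 1] f)) ⟨z, hz⟩
      have h2 : ‖(T (mulId^[n + 1] f) : w.H)‖ ≤ ‖f‖ :=
        (T.norm_map _).trans_le (norm_mulId_iterate_le f _)
      have h3 : ‖(T (mulId^[n + 1] f) : w.H) z‖ = x ^ (n + 1) * ‖(T f : w.H) z‖ := by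
        have h4 := congrArg norm (hpow n z hz)
        rw [norm_mul, norm_pow, norm_pow] at h4
        rw [hx, div_pow, ← h4]
        field_simp
        ring
      rw [le_div_iff₀ (mul_pos (w.pos z hz) hz0')]
      calc x ^ (n + 1) * (w z * ‖(T f : w.H) z‖)
          = w z * ‖(T (mulId^[n + 1] f) : w.H) z‖ := by rw [h3]; ring
        _ ≤ ‖f‖ := h1.trans h2
    obtain ⟨n, hn⟩ := pow_unbounded_of_one_lt (‖f‖ / (w z * ‖(T f : w.H) z‖)) hx1
    exact (hn.trans_le (pow_le_pow_right₀ hx1.le n.le_succ)).not_ge (hbound n)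
  have hTf0 : (T f : w.H) (Z 0) ≠ 0 := by
    rw [(hZ 0 h0).2.2]
    exact mul_ne_zero (hZ 0 h0).2.1 hf
  have hisol : ∀ z ∈ V, ∀ᶠ y in 𝓝[≠] z, (T f : w.H) y ≠ 0 := by
    intro z hz
    by_contra hfr
    exact hTf0 (((hd f).analyticOnNhd hVo).eqOn_zero_of_preconnected_of_frequently_eq_zero
      hVc.isPreconnected hz ((not_eventually.1 hfr).mono fun y hy => not_not.1 hy) (hZ 0 h0).1)
  obtain ⟨φ, hφd, hφ1, hφ⟩ := exists_differentiableOn_eq_mul_of_norm_le hVo (hd _) (hd f) hisol hle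
  have hT : ∀ g : v.H₀, ∀ z ∈ V, (T (mulId g) : w.H) z = φ z * (T g : w.H) z := by
    intro g
    have h1 : EqOn (fun z => (T (mulId g) : w.H) z * (T f : w.H) z)
        (fun z => (T (mulId f) : w.H) z * (T g : w.H) z) V :=
      hident _ _ ((hd _).fun_mul (hd _)) ((hd _).fun_mul (hd _)) fun a ha => by
        simp only [(hZ a ha).2.2, coe_mulId]
        ring
    have h2 := AnalyticOnNhd.eq_zero_or_eq_zero_of_mul_eq_zero
      (f := fun z => (T (mulId g) : w.H) z - φ z * (T g : w.H) z) (g := (T f : w.H))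
      (((hd _).fun_sub (hφd.fun_mul (hd _))).analyticOnNhd hVo) ((hd f).analyticOnNhd hVo)
      (fun z hz => by
        have h3 := h1 hz
        simp only [hφ z hz] at h3
        linear_combination h3) hVc.isPreconnected
    rcases h2 with h2 | h2
    · exact fun z hz => sub_eq_zero.1 (h2 z hz)
    · exact absurd (h2 _ (hZ 0 h0).1) hTf0
  have hφZ : ∀ a ∈ Metric.ball (0 : ℂ) 1, φ (Z a) = a := by
    intro a ha
    obtain ⟨g, hg⟩ := hne a ha
    obtain ⟨hZa, hκ, hTa⟩ := hZ a ha
    have := hT g _ hZa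
    rw [hTa, hTa, coe_mulId] at this
    exact mul_right_cancel₀ (mul_ne_zero hκ hg) (by linear_combination -this)
  have himage : φ '' V = Metric.ball 0 1 := by
    refine Subset.antisymm ?_ fun a ha => ⟨Z a, (hZ a ha).1, hφZ a ha⟩
    rintro _ ⟨z, hz, rfl⟩
    rw [mem_ball_zero_iff]
    -- If `|φ|` reached `1`, then `φ` would be constant of modulus `1`, yet `φ (Z 0) = 0`.
    refine lt_of_le_of_ne (hφ1 z hz) fun h1 => ?_
    have := Complex.eqOn_of_isPreconnected_of_isMaxOn_norm hVc.isPreconnected hVo hφd hz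
      (fun y hy => (hφ1 y hy).trans_eq h1.symm) (hZ 0 h0).1
    rw [hφZ 0 h0, Function.const_apply] at this
    rw [← this] at h1
    simp at h1
  exact ⟨φ, induces_of_forall_mulId hVo T hφd himage hne hT⟩

end Weight

/-! ### Baire category and critical values -/

/-- The easy case of Sard's theorem: the real Jacobian vanishes throughout `s`. -/
theorem volume_image_eq_zero_of_deriv_eq_zero {φ : ℂ → ℂ} {s : Set ℂ}
    (hd : ∀ z ∈ s, DifferentiableAt ℂ φ z) (h0 : ∀ z ∈ s, deriv φ z = 0) :
    MeasureTheory.volume (φ '' s) = 0 := by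
  refine MeasureTheory.addHaar_image_eq_zero_of_det_fderivWithin_eq_zero _
    (f' := fun _ => (0 : ℂ →L[ℝ] ℂ)) (fun z hz => ?_) (fun z hz => ?_)
  · have h1 := (hd z hz).hasDerivAt
    rw [h0 z hz] at h1
    have h2 := (h1.hasFDerivAt.restrictScalars ℝ).hasFDerivWithinAt (s := s)
    convert h2 using 1
    ext
    simp
  · simp [ContinuousLinearMap.det]

/-- A relatively closed set whose image under an analytic map contains a nonempty open set `W` has
interior points mapped into `W`. -/
theorem nonempty_interior_of_subset_image {V B W : Set ℂ} (hV : IsOpen V) (hBV : B ⊆ V)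
    (hB : ∀ D ⊆ V, IsCompact D → IsCompact (D ∩ B)) {φ : ℂ → ℂ} (hφ : DifferentiableOn ℂ φ V)
    (hWo : IsOpen W) (hW : W.Nonempty) (hWB : W ⊆ φ '' B) :
    (interior (B ∩ φ ⁻¹' W)).Nonempty := by
  have hinj : ∀ z : ℂ, ∃ O D : Set ℂ, z ∈ V ∩ {z | deriv φ z ≠ 0} → IsOpen O ∧ O ⊆ V ∧
      InjOn φ O ∧ IsCompact D ∧ D ⊆ O ∧ D ∈ 𝓝 z := by
    intro z
    by_cases hz : z ∈ V ∩ {z | deriv φ z ≠ 0}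
    · have hst : HasStrictDerivAt φ (deriv φ z) z :=
        ((hφ.analyticOnNhd hV) z hz.1).hasStrictDerivAt
      let e := (hst.hasStrictFDerivAt_equiv hz.2).toOpenPartialHomeomorph φ
      have hze : z ∈ e.source :=
        (hst.hasStrictFDerivAt_equiv hz.2).mem_toOpenPartialHomeomorph_source
      obtain ⟨D, hDn, hDs, hD⟩ := local_compact_nhds ((e.open_source.inter hV).mem_nhds ⟨hze, hz.1⟩)
      exact ⟨e.source ∩ V, D, fun _ => ⟨e.open_source.inter hV, inter_subset_right,
        e.injOn.mono inter_subset_left, hD, hDs, hDn⟩⟩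
    · exact ⟨∅, ∅, fun h => absurd h hz⟩
  choose O D hOD using hinj
  have hcpt : ∀ z : ℂ, ∃ K : Set ℂ, z ∈ V → IsCompact K ∧ K ⊆ V ∧ K ∈ 𝓝 z := by
    intro z
    by_cases hz : z ∈ V
    · obtain ⟨K, hKn, hKs, hK⟩ := local_compact_nhds (hV.mem_nhds hz)
      exact ⟨K, fun _ => ⟨hK, hKs, hKn⟩⟩
    · exact ⟨∅, fun h => absurd h hz⟩
  choose K hK using hcpt
  obtain ⟨t, htV, htc, ht⟩ := TopologicalSpace.countable_cover_nhdsWithin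
    (s := V ∩ {z | deriv φ z ≠ 0}) (f := D)
    fun z hz => mem_nhdsWithin_of_mem_nhds (hOD z hz).2.2.2.2.2
  obtain ⟨t', htV', htc', ht'⟩ := TopologicalSpace.countable_cover_nhdsWithin
    (s := V) (f := K) fun z hz => mem_nhdsWithin_of_mem_nhds (hK z hz).2.2
  let f : ℂ → Set ℂ := fun z => φ '' (D z ∩ B)
  let g : ℂ → Set ℂ := fun z => φ '' (K z ∩ deriv φ ⁻¹' {0})
  -- Baire's theorem is applied to countably many closed sets covering the plane: the complement of
  -- `W`, images of compact pieces of `B` on which `φ` is injective, and images of compact sets of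
  -- critical points, which are null.
  have hS : ∀ s ∈ insert Wᶜ (f '' t ∪ g '' t'), IsClosed s := by
    rintro s (rfl | ⟨z, hz, rfl⟩ | ⟨z, hz, rfl⟩)
    · exact hWo.isClosed_compl
    · obtain ⟨-, hOV, -, hDc, hDO, -⟩ := hOD z (htV hz)
      exact ((hB _ (hDO.trans hOV) hDc).image_of_continuousOn (hφ.continuousOn.mono
        (inter_subset_left.trans (hDO.trans hOV)))).isClosed
    · obtain ⟨hKc, hKV, -⟩ := hK z (htV' hz)
      have hcl : IsClosed (K z ∩ deriv φ ⁻¹' {0}) :=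
        ((hφ.deriv hV).continuousOn.mono hKV).preimage_isClosed_of_isClosed hKc.isClosed
          isClosed_singleton
      exact ((hKc.of_isClosed_subset hcl inter_subset_left).image_of_continuousOn
        (hφ.continuousOn.mono (inter_subset_left.trans hKV))).isClosed
  have hcov : ⋃₀ insert Wᶜ (f '' t ∪ g '' t') = univ := by
    refine eq_univ_of_forall fun y => ?_
    by_cases hy : y ∈ W
    · obtain ⟨b, hb, rfl⟩ := hWB hy
      by_cases hb0 : deriv φ b = 0
      · obtain ⟨z, hz, hbz⟩ := mem_iUnion₂.1 (ht' (hBV hb))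
        exact ⟨g z, Or.inr (Or.inr ⟨z, hz, rfl⟩), b, ⟨hbz, hb0⟩, rfl⟩
      · obtain ⟨z, hz, hbz⟩ := mem_iUnion₂.1 (ht ⟨hBV hb, hb0⟩)
        exact ⟨f z, Or.inr (Or.inl ⟨z, hz, rfl⟩), b, ⟨hbz, hb⟩, rfl⟩
    · exact ⟨Wᶜ, Or.inl rfl, hy⟩
  have hdense := dense_sUnion_interior_of_closed hS
    (((htc.image f).union (htc'.image g)).insert _) hcov
  obtain ⟨y, hyW, hy⟩ := hdense.inter_open_nonempty W hWo hW
  obtain ⟨s, hs, hys⟩ := mem_iUnion₂.1 hy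
  rcases hs with rfl | ⟨z, hz, rfl⟩ | ⟨z, hz, rfl⟩
  · exact absurd hyW (interior_subset hys)
  · obtain ⟨hO, hOV, hOi, -, hDO, -⟩ := hOD z (htV hz)
    obtain ⟨x, ⟨hxD, hxB⟩, rfl⟩ := interior_subset hys
    -- A point of this open set has the same image as some point of `D z ∩ B`; injectivity on `O z`
    -- makes the two equal.
    have hopen : IsOpen (O z ∩ φ ⁻¹' (interior (f z) ∩ W)) :=
      (hφ.continuousOn.mono hOV).isOpen_inter_preimage hO (isOpen_interior.inter hWo)
    refine ⟨x, mem_interior.2 ⟨_, ?_, hopen, hDO hxD, hys, hyW⟩⟩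
    rintro p ⟨hpO, hp, hpW⟩
    obtain ⟨q, ⟨hqD, hqB⟩, hqp⟩ := interior_subset hp
    exact ⟨hOi (hDO hqD) hpO hqp ▸ hqB, hpW⟩
  · obtain ⟨-, hKV, -⟩ := hK z (htV' hz)
    have hnull : MeasureTheory.volume (g z) = 0 := volume_image_eq_zero_of_deriv_eq_zero
      (fun x hx => hφ.differentiableAt (hV.mem_nhds (hKV hx.1))) fun x hx => hx.2
    rw [MeasureTheory.Measure.interior_eq_empty_of_null hnull] at hys
    exact hys.elim

/-! ### Interior points of the isometry boundary -/

namespace Weight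

variable {V : Set ℂ} {v : Weight (Metric.ball (0 : ℂ) 1)} {w : Weight V}

theorem norm_smul_eval_comp_subtypeL_le (E : Submodule ℂ w.H) (z : V) :
    ‖(w z : ℂ) • (w.eval z).comp E.subtypeL‖ ≤ 1 := by
  refine ContinuousLinearMap.opNorm_le_bound _ zero_le_one fun f => ?_
  change ‖(w z : ℂ) * (f : w.H) z‖ ≤ 1 * ‖(f : w.H)‖
  rw [norm_mul, Complex.norm_real, Real.norm_of_nonneg (w.pos z z.2).le, one_mul]
  exact w.le_norm f z

/-- Extremality is transported from `v(φ z)δ_{φ z}` along the surjective isometry `S` onto the range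
of `T`. -/
theorem mem_isometryBoundary (hv : v.IsComplete) {T : v.H₀ →ₗᵢ[ℂ] w.H₀} {φ h : ℂ → ℂ}
    (hT : Induces T φ h) {z : ℂ} (hz : z ∈ V) (hle : v (φ z) ≤ w z * ‖h z‖) :
    z ∈ isometryBoundary T := by
  have hφz : φ z ∈ Metric.ball (0 : ℂ) 1 := hT.image_eq ▸ mem_image_of_mem φ hz
  obtain ⟨_, hext⟩ : φ z ∈ v.boundary := by rw [hv]; exact hφz
  let F := (LinearMap.range T.toLinearMap).map w.H₀.subtype
  let S : v.H₀ →L[ℂ] F := LinearMap.mkContinuous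
    { toFun := fun g => (⟨T g, T g, ⟨g, rfl⟩, rfl⟩ : F)
      map_add' := fun x y => Subtype.ext (by simp)
      map_smul' := fun c x => Subtype.ext (by simp) } 1 fun g => by
        rw [one_mul]
        exact (T.norm_map g).le
  have hS1 : ∀ g, ‖S g‖ = ‖g‖ := T.norm_map
  have hSs : Function.Surjective S := by
    rintro ⟨_, _, ⟨g, rfl⟩, rfl⟩
    exact ⟨g, rfl⟩
  have hv0 : 0 < v (φ z) := v.pos _ hφz
  -- Pulled back by `S`, `w(z)δ_z` becomes `μ v(φ z)δ_{φ z}`. As `‖μ‖ ≥ 1`, pulling back and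
  -- dividing by `μ` maps the dual ball into the dual ball.
  let μ : ℂ := w z * h z / v (φ z)
  have hμ : 1 ≤ ‖μ‖ := by
    simp only [μ, norm_div, norm_mul, Complex.norm_real]
    rw [Real.norm_of_nonneg hv0.le, Real.norm_of_nonneg (w.pos z hz).le, one_le_div hv0]
    exact hle
  have hμ0 : μ ≠ 0 := norm_pos_iff.1 (zero_lt_one.trans_le hμ)
  have hμi : ‖μ⁻¹‖ ≤ 1 := by rw [norm_inv]; exact inv_le_one_of_one_le₀ hμ
  have hcomp : ∀ x : StrongDual ℂ F, ‖x‖ ≤ 1 → ‖μ⁻¹ • x.comp S‖ ≤ 1 := fun x hx => by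
    refine ContinuousLinearMap.opNorm_le_bound _ zero_le_one fun g => ?_
    change ‖μ⁻¹ * x (S g)‖ ≤ 1 * ‖g‖
    rw [norm_mul, ← hS1 g]
    exact mul_le_mul hμi ((x.le_of_opNorm_le hx _).trans_eq (one_mul _)) (norm_nonneg _) zero_le_one
  have heval : μ⁻¹ • ((w z : ℂ) • (w.eval ⟨z, hz⟩).comp F.subtypeL).comp S =
      (v (φ z) : ℂ) • (v.eval ⟨φ z, hφz⟩).comp v.H₀.subtypeL := by
    ext g
    change μ⁻¹ * (w z * (T g : w.H) z) = v (φ z) * (g : v.H) (φ z)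
    have hv0' : (v (φ z) : ℂ) ≠ 0 := by exact_mod_cast hv0.ne'
    rw [hT.apply_eq g z hz, inv_mul_eq_iff_eq_mul₀ hμ0]
    simp only [μ]
    field_simp
  refine ⟨hz, norm_smul_eval_comp_subtypeL_le F ⟨z, hz⟩, fun x hx y hy hxy => ?_⟩
  obtain ⟨s, t, hs, ht, hst, hsum⟩ := hxy
  have key := hext.2 (hcomp x hx) (hcomp y hy) ⟨s, t, hs, ht, hst, by
    rw [← heval, ← hsum]
    ext g
    simp only [add_apply, smul_apply,
      ContinuousLinearMap.comp_apply, Complex.real_smul, smul_eq_mul]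
    ring⟩
  rw [← heval] at key
  ext k
  obtain ⟨g, rfl⟩ := hSs k
  exact mul_left_cancel₀ (inv_ne_zero hμ0) (DFunLike.congr_fun key g)

/-- The dual of the zero space is a single point, which is extreme. Part (ii) includes this
degenerate case. -/
theorem subset_isometryBoundary_of_subsingleton [Subsingleton v.H₀] (T : v.H₀ →ₗᵢ[ℂ] w.H₀) :
    V ⊆ isometryBoundary T := by
  intro z hz
  refine ⟨hz, norm_smul_eval_comp_subtypeL_le _ ⟨z, hz⟩, fun x _ y _ _ => ?_⟩
  ext ⟨_, _, ⟨g, rfl⟩, rfl⟩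
  have hg : g = 0 := Subsingleton.elim _ _
  subst hg
  refine (congrArg x ?_).trans ((map_zero x).trans ((map_zero _).symm.trans (congrArg _ ?_)))
  · exact Subtype.ext (by simp)
  · exact Subtype.ext (by simp)

/-- In `v(a)δ_a = c w(z) δ_z ∘ T`, comparing `f` with `mulId f` gives `φ z = a`, and `‖c‖ ≤ 1` gives
the inequality. -/
theorem Induces.exists_le (hv : v.IsComplete) [Nontrivial v.H₀] {T : v.H₀ →ₗᵢ[ℂ] w.H₀}
    {φ h : ℂ → ℂ} (hT : Induces T φ h) {a : ℂ} (ha : a ∈ Metric.ball (0 : ℂ) 1) :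
    ∃ z ∈ V, φ z = a ∧ v a ≤ w z * ‖h z‖ := by
  obtain ⟨⟨f, hf⟩, z, hz, c, hc, hcz⟩ := exists_eval_eq hv T ha
  have hva : (v a : ℂ) ≠ 0 := by exact_mod_cast (v.pos a ha).ne'
  have h1 := hcz f
  have h2 := hcz (mulId f)
  rw [hT.apply_eq _ z hz] at h1 h2
  rw [coe_mulId, coe_mulId] at h2
  have hφ : φ z = a := by
    have h3 : v a * (f : v.H) a * (φ z - a) = 0 := by linear_combination φ z * h1 - h2
    exact sub_eq_zero.1 ((mul_eq_zero.1 h3).resolve_left (mul_ne_zero hva hf))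
  refine ⟨z, hz, hφ, ?_⟩
  rw [hφ] at h1
  have h4 := congrArg norm h1
  simp only [norm_mul, Complex.norm_real, Real.norm_of_nonneg (v.pos a ha).le,
    Real.norm_of_nonneg (w.pos z hz).le] at h4
  refine le_of_mul_le_mul_right ?_ (norm_pos_iff.2 hf)
  calc v a * ‖(f : v.H) a‖ = ‖c‖ * (w z * (‖h z‖ * ‖(f : v.H) a‖)) := h4
    _ ≤ 1 * (w z * (‖h z‖ * ‖(f : v.H) a‖)) := by
      have := (w.pos z hz).le
      gcongr
    _ = w z * ‖h z‖ * ‖(f : v.H) a‖ := by ring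

/-- In the nontrivial case the Baire argument needs a relatively closed set, so it runs on `{v ∘ φ ≤
w |h|}` and not on the isometry boundary itself. -/
theorem Induces.nonempty_interior_isometryBoundary (hVo : IsOpen V) (hv : v.IsComplete)
    {T : v.H₀ →ₗᵢ[ℂ] w.H₀} {φ h : ℂ → ℂ} (hT : Induces T φ h) {W : Set ℂ} (hWo : IsOpen W)
    (hW : W.Nonempty) (hWU : W ⊆ Metric.ball 0 1) :
    (interior (isometryBoundary T ∩ φ ⁻¹' W)).Nonempty := by
  have hφc := hT.differentiableOn_map.continuousOn
  rcases subsingleton_or_nontrivial v.H₀ with hE | hE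
  · obtain ⟨y, hy⟩ := hW
    obtain ⟨z, hz, rfl⟩ : y ∈ φ '' V := hT.image_eq ▸ hWU hy
    exact ⟨z, mem_interior.2 ⟨V ∩ φ ⁻¹' W,
      inter_subset_inter_left _ (subset_isometryBoundary_of_subsingleton T),
      hφc.isOpen_inter_preimage hVo hWo, hz, hy⟩⟩
  · refine (nonempty_interior_of_subset_image (B := {z ∈ V | v (φ z) ≤ w z * ‖h z‖}) hVo
      (fun z hz => hz.1) (fun D hDV hD => ?_) hT.differentiableOn_map hWo hW fun a ha => ?_).mono
      (interior_mono (inter_subset_inter_left _ fun z hz => mem_isometryBoundary hv hT hz.1 hz.2))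
    · have hcl : IsClosed {z ∈ D | v (φ z) ≤ w z * ‖h z‖} :=
        hD.isClosed.isClosed_le (v.continuousOn.comp (hφc.mono hDV) fun z hz =>
          hT.image_eq ▸ mem_image_of_mem φ (hDV hz))
          ((w.continuousOn.mono hDV).mul (hT.differentiableOn_factor.continuousOn.mono hDV).norm)
      convert hD.of_isClosed_subset hcl (sep_subset _ _) using 1
      ext z
      exact ⟨fun hz => ⟨hz.1, hz.2.2⟩, fun hz => ⟨hz.1, hDV hz.1, hz.2⟩⟩
    · obtain ⟨z, hz, rfl, hle⟩ := hT.exists_le hv (hWU ha)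
      exact ⟨z, ⟨hz, hle⟩, rfl⟩

end Weight

theorem corollary4p2 {V : Set ℂ} (hVo : IsOpen V) (hVb : Bornology.IsBounded V)
    (v : Weight (Metric.ball (0 : ℂ) 1)) (w : Weight V) (hv : v.IsComplete)
    (T : v.H₀ →ₗᵢ[ℂ] w.H₀) :
    (IsConnected V → Nontrivial v.H₀ → ∃ φ h : ℂ → ℂ, Weight.Induces T φ h) ∧
    ∀ φ h : ℂ → ℂ, Weight.Induces T φ h →
      ∀ a ∈ Metric.ball (0 : ℂ) 1, ∀ r : ℝ, 0 < r →
        (interior (closure (Weight.isometryBoundary T ∩ φ ⁻¹' Metric.ball a r))).Nonempty := by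
  refine ⟨fun hVc _ => Weight.exists_induces hVo hVc hv T, fun φ h hT a ha r hr => ?_⟩
  refine (hT.nonempty_interior_isometryBoundary hVo hv
    (Metric.isOpen_ball.inter Metric.isOpen_ball) (W := Metric.ball a r ∩ Metric.ball 0 1)
    ⟨a, Metric.mem_ball_self hr, ha⟩ inter_subset_right).mono (interior_mono ?_)
  exact (inter_subset_inter_right _ (preimage_mono inter_subset_left)).trans subset_closure
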